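/- For an odd integer $t\ge 3$, let $I(t)=\{1,3,5,\dots,2t-1\}\setminus\{t\}$. A $t$-Schur overpartition of $n$ is a partition of $n$ all of whose parts are congruent modulo $2t$ to an element of $I(t)$, and in which the first occurrence of each part size may be overlined. Let $\overline{S}_t(n)$ denote the number of $t$-Schur overpartitions of $n$; equivalently, \[ \sum_{n\ge 0}\overline{S}_t(n)q^n=\prod_{n\ge 1}\frac{(1+q^{2n-1})(1-q^{t(2n-1)})}{(1+q^{t(2n-1)})(1-q^{2n-1})}. \] Then, for all integers $n\ge 0$, \[ \overline{S}_9(12n+11)\equiv 0 \pmod{16}\qquad\text{and}\qquad \overline{S}_9(24n+23)\equiv 0 \pmod{32}. \] -/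

import Mathlib

/-- The set `I(t) = {1, 3, 5, …, 2t - 1} \ {t}` of admissible residues modulo `2t`. -/
def schurResidues (t : ℕ) : Finset ℕ :=
  ((Finset.range (2 * t)).filter fun i => Odd i).erase t

/-- The `t`-Schur partitions of `n`: the partitions of `n` all of whose parts are congruent
modulo `2t` to an element of `I(t)`. -/
def schurPartitions (t n : ℕ) : Finset n.Partition :=
  Finset.univ.filter fun p => ∀ m ∈ p.parts, m % (2 * t) ∈ schurResidues t

/-- The `t`-Schur overpartitions of `n`. An overpartition is a partition in which the first
occurrence of each part size may be overlined, so it is recorded as a pair `⟨p, s⟩` with `p` the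
underlying partition and `s` the set of those part sizes of `p` whose first occurrence is
overlined. -/
def schurOverpartitions (t n : ℕ) : Finset (Σ _ : n.Partition, Finset ℕ) :=
  (schurPartitions t n).sigma fun p => p.parts.toFinset.powerset

/-- The number of `t`-Schur overpartitions of `n`. -/
def numSchurOverpartitions (t n : ℕ) : ℕ :=
  (schurOverpartitions t n).card

/-! Write φ(q) = ∑ q^(j²) over j ∈ ℤ and S for the generating function. Gauss's product φ(-q) = ∏
(1-q^(2i))(1-q^(2i-1))² gives S = φ(q)φ(-q⁹)/(φ(-q²)φ(-q¹⁸)). Multiplying through by φ(q²)φ(q¹⁸) and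
using φ(q)φ(-q) = φ(-q²)² yields S·D = φ(q)φ(-q⁹)φ(q²)φ(q¹⁸) with D = (φ(-q⁴)φ(-q³⁶))²
(`schurGenFun_mul_theta`).

As D is a series in q⁴, taking exponents 3 mod 4 commutes with multiplication by D. Splitting each
theta series by the parity of j shows that this part of the right side is 4H
(`expPart_schurGenFun_mul`), so the corresponding part of S is 4H/D.

Splitting further by divisibility of j by 3 shows that H has no exponent 2 mod 3
(`expMod_three_thetaQuarter`). Since D = 1 + 4E, H/D ≡ H mod 4, which gives 16. For 32, H/D ≡ H -
4EH mod 8: modulo 2, H has only exponents 3 mod 24 (`thetaQuarter_eq`) and E none that are 20 mod 24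
(`theta_mul_theta_sq_eq`), so EH has even coefficients at exponents 23 mod 24. -/

open Finset PowerSeries Filter
open scoped PowerSeries.WithPiTopology

/-! ### Gaussian binomials and the finite Gauss identity -/

/-- The Gaussian binomial coefficient at `q`. -/
def qChoose {R : Type*} [CommRing R] (q : R) : ℕ → ℕ → R
  | _, 0 => 1
  | 0, _ + 1 => 0
  | n + 1, k + 1 => qChoose q n k + q ^ (k + 1) * qChoose q n (k + 1)

/-- The `q`-Pochhammer symbol `(q; q)_n`. -/
def qFac {R : Type*} [CommRing R] (q : R) (n : ℕ) : R :=
  ∏ i ∈ range n, (1 - q ^ (i + 1))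

section

variable {R : Type*} [CommRing R] (q : R)

@[simp] lemma qChoose_zero_right (n : ℕ) : qChoose q n 0 = 1 := by
  cases n <;> rfl

lemma qChoose_succ_succ (n k : ℕ) :
    qChoose q (n + 1) (k + 1) = qChoose q n k + q ^ (k + 1) * qChoose q n (k + 1) := rfl

lemma qChoose_of_lt {n k : ℕ} (h : n < k) : qChoose q n k = 0 := by
  induction n generalizing k with
  | zero => cases k with
    | zero => omega
    | succ k => rfl
  | succ n ih => cases k with
    | zero => omega
    | succ k => rw [qChoose_succ_succ, ih (by omega), ih (by omega)]; ring

@[simp] lemma qChoose_self (n : ℕ) : qChoose q n n = 1 := by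
  induction n with
  | zero => rfl
  | succ n ih => rw [qChoose_succ_succ, ih, qChoose_of_lt q (Nat.lt_succ_self n)]; ring

@[simp] lemma qFac_zero : qFac q 0 = 1 := rfl

lemma qFac_succ (n : ℕ) : qFac q (n + 1) = qFac q n * (1 - q ^ (n + 1)) :=
  prod_range_succ _ _

lemma qChoose_mul_qFac_mul_qFac (a b : ℕ) :
    qChoose q (a + b) b * (qFac q a * qFac q b) = qFac q (a + b) := by
  induction h : a + b generalizing a b with
  | zero =>
    obtain ⟨rfl, rfl⟩ : a = 0 ∧ b = 0 := by omega
    simp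
  | succ n ih =>
    rcases b with _ | b
    · obtain rfl : a = n + 1 := by omega
      simp
    rcases a with _ | a
    · obtain rfl : b = n := by omega
      simp
    have h1 := ih (a + 1) b (by omega)
    have h2 := ih a (b + 1) (by omega)
    have h3 : q ^ (n + 1) = q ^ (a + 1) * q ^ (b + 1) := by
      rw [← pow_add]; congr 1; omega
    rw [qChoose_succ_succ, qFac_succ q n, h3]
    rw [qFac_succ q a] at h1 ⊢
    rw [qFac_succ q b] at h2 ⊢
    linear_combination (1 - q ^ (b + 1)) * h1 + q ^ (b + 1) * (1 - q ^ (a + 1)) * h2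

/-- The `q`-binomial theorem. -/
lemma prod_add_mul_pow_eq_sum (a b : R) (n : ℕ) :
    ∏ k ∈ range n, (a + b * q ^ k) =
      ∑ j ∈ range (n + 1), q ^ (j.choose 2) * qChoose q n j * b ^ j * a ^ (n - j) := by
  induction n generalizing b with
  | zero => simp
  | succ n ih =>
    have h0 : ∏ k ∈ range n, (a + b * q ^ (k + 1)) = ∏ k ∈ range n, (a + (b * q) * q ^ k) :=
      prod_congr rfl fun k _ => by ring
    rw [prod_range_succ', h0, ih, mul_comm, pow_zero, mul_one, add_mul, sum_range_succ' _ (n + 1)]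
    have h1 : a * ∑ j ∈ range (n + 1), q ^ (j.choose 2) * qChoose q n j * (b * q) ^ j * a ^ (n - j)
        = ∑ j ∈ range (n + 1), q ^ ((j + 1).choose 2) * (q ^ (j + 1) * qChoose q n (j + 1)) *
          b ^ (j + 1) * a ^ (n - j) + a ^ (n + 1) := by
      rw [sum_range_succ', sum_range_succ _ n, qChoose_of_lt q (Nat.lt_succ_self n), mul_add,
        mul_sum]
      simp only [mul_zero, zero_mul, add_zero]
      congr 1
      · refine sum_congr rfl fun j hj => ?_
        have : n - j = n - (j + 1) + 1 := by have := mem_range.1 hj; omega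
        rw [this]; ring
      · simp; ring
    rw [h1, mul_sum, add_right_comm, ← sum_add_distrib]
    congr 1
    · refine sum_congr rfl fun j _ => ?_
      rw [qChoose_succ_succ, Nat.add_sub_add_right, Nat.choose_succ_succ' j 1, Nat.choose_one_right]
      ring
    · simp

lemma qFac_add_sub_dvd (m n : ℕ) : q ^ (m + 1) ∣ qFac q (m + n) - qFac q m := by
  induction n with
  | zero => simp
  | succ n ih =>
    have : qFac q (m + (n + 1)) - qFac q m =
        (qFac q (m + n) - qFac q m) - q ^ (m + 1) * (q ^ n * qFac q (m + n)) := by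
      rw [← add_assoc, qFac_succ]; ring
    rw [this]
    exact dvd_sub ih (dvd_mul_right _ _)

/-- A finite form of Gauss's product for `∑ (-1)^j q^(j^2)`. -/
lemma sum_qChoose_sq [IsDomain R] (hq : q ≠ 0) (n : ℕ) :
    (∏ k ∈ range n, (1 - q ^ (2 * k + 1))) ^ 2 =
      qChoose (q ^ 2) (2 * n) n + ∑ i ∈ range n, (-1) ^ (i + 1) * q ^ ((i + 1) ^ 2) *
        (qChoose (q ^ 2) (2 * n) (n + (i + 1)) + qChoose (q ^ 2) (2 * n) (n - (i + 1))) := by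
  rcases n with _ | m
  · simp
  obtain ⟨n, hn⟩ : ∃ n, n = m + 1 := ⟨_, rfl⟩
  rw [← hn]
  -- Taking a = q^(2n-1) and b = -1 in base q² avoids negative powers of q. Each half of the product
  -- is ∏ (1 - q^(2k+1)) up to a signed monomial; the two monomials multiply to the constant
  -- cancelled next.
  have key := prod_add_mul_pow_eq_sum (q ^ 2) (q ^ (2 * m + 1)) (-1) (n + n)
  have hc : ((-1 : R) ^ n * q ^ (3 * m ^ 2 + 4 * m + 1)) ≠ 0 :=
    mul_ne_zero (pow_ne_zero _ (by simp)) (pow_ne_zero _ hq)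
  apply mul_left_cancel₀ hc
  have hL : ∏ k ∈ range (n + n), (q ^ (2 * m + 1) + -1 * (q ^ 2) ^ k) =
      ((-1 : R) ^ n * q ^ (3 * m ^ 2 + 4 * m + 1)) *
        (∏ k ∈ range n, (1 - q ^ (2 * k + 1))) ^ 2 := by
    rw [prod_range_add]
    have e1 : ∏ k ∈ range n, (q ^ (2 * m + 1) + -1 * (q ^ 2) ^ k) =
        (-1) ^ n * q ^ (m * (m + 1)) * ∏ k ∈ range n, (1 - q ^ (2 * k + 1)) := by
      rw [← prod_range_reflect (fun k => 1 - q ^ (2 * k + 1))]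
      have : q ^ (m * (m + 1)) = ∏ k ∈ range n, q ^ (2 * k) := by
        rw [prod_pow_eq_pow_sum, ← mul_sum, mul_comm 2, sum_range_id_mul_two, hn]
        congr 1; simp [mul_comm]
      rw [this]
      have h1 : ((-1 : R) ^ n) = ∏ k ∈ range n, (-1 : R) := by simp
      rw [h1, ← prod_mul_distrib, ← prod_mul_distrib]
      refine prod_congr rfl fun k hk => ?_
      have hk := mem_range.1 hk
      have : 2 * m + 1 = 2 * k + (2 * (n - 1 - k) + 1) := by omega
      rw [this, pow_add]; ring
    have e2 : ∏ k ∈ range n, (q ^ (2 * m + 1) + -1 * (q ^ 2) ^ (n + k)) =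
        q ^ ((2 * m + 1) * (m + 1)) * ∏ k ∈ range n, (1 - q ^ (2 * k + 1)) := by
      have : q ^ ((2 * m + 1) * (m + 1)) = ∏ k ∈ range n, q ^ (2 * m + 1) := by
        simp [hn, pow_mul]
      rw [this, ← prod_mul_distrib]
      refine prod_congr rfl fun k _ => ?_
      rw [hn]; ring
    rw [e1, e2]; ring
  rw [← hL, key, add_assoc n n 1, sum_range_add, sum_range_succ' _ n]
  have hch (j : ℕ) : (q ^ 2) ^ (j.choose 2) = q ^ (j * (j - 1)) := by
    rw [← pow_mul, mul_comm 2, Nat.choose_two_right,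
      Nat.div_mul_cancel (Nat.even_mul_pred_self j).two_dvd]
  rw [← sum_range_reflect, mul_add, mul_sum, ← add_assoc, ← sum_add_distrib, add_comm]
  congr 1
  · rw [hch, two_mul n, add_zero, Nat.add_sub_cancel, ← pow_mul]
    have : q ^ (3 * m ^ 2 + 4 * m + 1) = q ^ (n * (n - 1)) * q ^ ((2 * m + 1) * n) := by
      rw [← pow_add]; congr 1; simp only [hn, Nat.add_sub_cancel]; ring
    rw [this]; ring
  · refine sum_congr rfl fun i hi => ?_
    have hi := mem_range.1 hi
    rw [hch, hch, ← two_mul, ← pow_mul, ← pow_mul]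
    obtain ⟨c, hc⟩ : ∃ c, m = i + c := ⟨m - i, by omega⟩
    have a1 : n - 1 - i = c := by omega
    have a2 : n - (i + 1) = c := by omega
    have a3 : 2 * n - c = 2 * i + c + 2 := by omega
    have a4 : 2 * n - (n + (i + 1)) = c := by omega
    have a5 : n + (i + 1) - 1 = 2 * i + c + 1 := by omega
    rw [a1, a2, a3, a4, a5]
    have b1 : q ^ (c * (c - 1)) * q ^ ((2 * m + 1) * (2 * i + c + 2)) =
        q ^ (3 * m ^ 2 + 4 * m + 1) * q ^ ((i + 1) ^ 2) := by
      rw [← pow_add, ← pow_add]; congr 1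
      rcases c with _ | c
      · simp [hc]; ring
      · simp only [Nat.add_sub_cancel, hc]; ring
    have b2 : q ^ ((n + (i + 1)) * (2 * i + c + 1)) * q ^ ((2 * m + 1) * c) =
        q ^ (3 * m ^ 2 + 4 * m + 1) * q ^ ((i + 1) ^ 2) := by
      rw [← pow_add, ← pow_add]; congr 1
      simp only [hc, hn]; ring
    have b3 : (-1 : R) ^ n * (-1) ^ (i + 1) = (-1) ^ c := by
      rw [← pow_add, show n + (i + 1) = c + 2 * (i + 1) by omega, pow_add, pow_mul]; simp
    have b4 : (-1 : R) ^ n * (-1) ^ (i + 1) = (-1) ^ (n + (i + 1)) := (pow_add _ _ _).symm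
    linear_combination (qChoose (q ^ 2) (2 * n) c * (-1) ^ c) * b1
      + (qChoose (q ^ 2) (2 * n) (n + (i + 1)) * (-1) ^ (n + (i + 1))) * b2
      - q ^ (3 * m ^ 2 + 4 * m + 1) * q ^ ((i + 1) ^ 2) * qChoose (q ^ 2) (2 * n) c * b3
      - q ^ (3 * m ^ 2 + 4 * m + 1) * q ^ ((i + 1) ^ 2) *
        qChoose (q ^ 2) (2 * n) (n + (i + 1)) * b4

end

/-! ### Theta series and Gauss's product -/

/-- The power series `∑_{j ≥ 1} c_j X^(k j^2)`, for `k ≥ 1`. -/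
noncomputable def sqSeries (k : ℕ) (c : ℕ → ℤ) : ℤ⟦X⟧ :=
  PowerSeries.mk fun n => ∑ j ∈ Icc 1 n, if k * j ^ 2 = n then c j else 0

lemma coeff_sqSeries {k : ℕ} (hk : 0 < k) (c : ℕ → ℤ) {n N : ℕ} (h : n ≤ N) :
    coeff n (sqSeries k c) = ∑ j ∈ Icc 1 N, if k * j ^ 2 = n then c j else 0 := by
  rw [sqSeries, coeff_mk]
  refine sum_subset (Icc_subset_Icc_right h) fun j hj hj' => ?_
  rw [mem_Icc] at hj hj'
  rw [if_neg]
  intro he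
  have : 1 * j ≤ k * j ^ 2 := Nat.mul_le_mul hk (Nat.le_self_pow two_ne_zero j)
  omega

lemma X_pow_dvd_sqSeries_sub {k : ℕ} (hk : 0 < k) (c : ℕ → ℤ) (N : ℕ) :
    X ^ N ∣ sqSeries k c - ∑ j ∈ range N, C (c (j + 1)) * X ^ (k * (j + 1) ^ 2) := by
  rw [X_pow_dvd_iff]
  intro m hm
  rw [map_sub, coeff_sqSeries hk c hm.le, map_sum, sub_eq_zero, ← Ico_add_one_right_eq_Icc,
    sum_Ico_eq_sum_range, Nat.add_sub_cancel]
  refine sum_congr rfl fun j _ => ?_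
  rw [coeff_C_mul, coeff_X_pow, add_comm 1 j]
  simp only [mul_ite, mul_one, mul_zero, eq_comm]

/-- The theta series `∑_{j ∈ ℤ} ε^j X^(k j^2)`, for `ε = ±1`. -/
noncomputable def theta (k : ℕ) (ε : ℤ) : ℤ⟦X⟧ :=
  1 + 2 * sqSeries k fun j => ε ^ j

section products

variable {y : ℤ⟦X⟧}

lemma isUnit_qFac (hy : X ∣ y) (n : ℕ) : IsUnit (qFac y n) := by
  rw [isUnit_iff_constantCoeff, qFac, map_prod]
  rw [X_dvd_iff] at hy
  simp [hy]

/-- Multiplying by the units (y²;y²)_(n-i) and (y²;y²)_(n+i) leaves differences of Pochhammer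
symbols. The worse one is divisible only by y^(2(n-i+1)); the factor y^(i²) makes up the deficit
because (i-1)² ≥ 0. -/
lemma dvd_pow_mul_qChoose_mul_qFac_sub_one (hy : X ∣ y) {n i a b : ℕ} (hi : i ≤ n)
    (hab : a = n - i ∧ b = n + i ∨ a = n + i ∧ b = n - i) :
    y ^ n ∣ y ^ i ^ 2 * (qChoose (y ^ 2) (2 * n) b * qFac (y ^ 2) n - 1) := by
  have hy2 : X ∣ y ^ 2 := dvd_pow hy two_ne_zero
  obtain ⟨c, rfl⟩ : ∃ c, n = i + c := ⟨n - i, by omega⟩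
  have huv := (isUnit_qFac hy2 c).mul (isUnit_qFac hy2 (c + 2 * i))
  have hB : qChoose (y ^ 2) (2 * (i + c)) b * (qFac (y ^ 2) c * qFac (y ^ 2) (c + 2 * i)) =
      qFac (y ^ 2) (2 * (i + c)) := by
    rcases hab with ⟨rfl, rfl⟩ | ⟨rfl, rfl⟩
    · have := qChoose_mul_qFac_mul_qFac (y ^ 2) c (c + 2 * i)
      rw [show c + (c + 2 * i) = 2 * (i + c) by ring] at this
      rw [show i + c + i = c + 2 * i by ring, this]
    · have := qChoose_mul_qFac_mul_qFac (y ^ 2) (c + 2 * i) c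
      rw [show c + 2 * i + c = 2 * (i + c) by ring, mul_comm (qFac _ _) (qFac _ c)] at this
      rw [Nat.add_sub_cancel_left, this]
  rw [← huv.dvd_mul_right]
  have h1 := qFac_add_sub_dvd (y ^ 2) c i
  have h2 := qFac_add_sub_dvd (y ^ 2) (c + 2 * i) c
  rw [show c + 2 * i + c = 2 * (i + c) by ring] at h2
  rw [add_comm c i] at h1
  have e : y ^ i ^ 2 * (qChoose (y ^ 2) (2 * (i + c)) b * qFac (y ^ 2) (i + c) - 1) *
      (qFac (y ^ 2) c * qFac (y ^ 2) (c + 2 * i)) =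
      y ^ i ^ 2 * (qFac (y ^ 2) (i + c) - qFac (y ^ 2) c) * qFac (y ^ 2) (2 * (i + c)) +
      (qFac (y ^ 2) (2 * (i + c)) - qFac (y ^ 2) (c + 2 * i)) * (y ^ i ^ 2 * qFac (y ^ 2) c) := by
    linear_combination y ^ i ^ 2 * qFac (y ^ 2) (i + c) * hB
  rw [e]
  refine dvd_add (Dvd.dvd.mul_right (dvd_trans ?_ (mul_dvd_mul_left _ h1)) _)
    (Dvd.dvd.mul_right (dvd_trans ?_ h2) _)
  · rw [← pow_mul, ← pow_add]
    exact pow_dvd_pow _ (by nlinarith [sq_nonneg (i - 1 : ℤ)])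
  · rw [← pow_mul]
    exact pow_dvd_pow _ (by omega)

lemma pow_dvd_gauss_sub (hy : X ∣ y) (hy0 : y ≠ 0) (n : ℕ) :
    y ^ n ∣ qFac (y ^ 2) n * (∏ k ∈ range n, (1 - y ^ (2 * k + 1))) ^ 2 -
      (1 + 2 * ∑ i ∈ range n, (-1) ^ (i + 1) * y ^ (i + 1) ^ 2) := by
  rw [sum_qChoose_sq y hy0]
  have e : qFac (y ^ 2) n * (qChoose (y ^ 2) (2 * n) n + ∑ i ∈ range n,
        (-1) ^ (i + 1) * y ^ ((i + 1) ^ 2) *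
        (qChoose (y ^ 2) (2 * n) (n + (i + 1)) + qChoose (y ^ 2) (2 * n) (n - (i + 1)))) -
      (1 + 2 * ∑ i ∈ range n, (-1) ^ (i + 1) * y ^ (i + 1) ^ 2) =
      (y ^ 0 ^ 2 * (qChoose (y ^ 2) (2 * n) n * qFac (y ^ 2) n - 1)) + ∑ i ∈ range n,
        (-1) ^ (i + 1) *
        (y ^ ((i + 1) ^ 2) * (qChoose (y ^ 2) (2 * n) (n + (i + 1)) * qFac (y ^ 2) n - 1) +
         y ^ ((i + 1) ^ 2) * (qChoose (y ^ 2) (2 * n) (n - (i + 1)) * qFac (y ^ 2) n - 1)) := by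
    rw [mul_add, mul_sum, mul_sum, add_sub_add_comm, ← sum_sub_distrib]
    congr 1
    · simp; ring
    · exact sum_congr rfl fun i _ => by ring
  rw [e]
  refine dvd_add (dvd_pow_mul_qChoose_mul_qFac_sub_one hy (a := n) (Nat.zero_le n) (by simp))
    (dvd_sum fun i hi => Dvd.dvd.mul_left (dvd_add ?_ ?_) _)
  · exact dvd_pow_mul_qChoose_mul_qFac_sub_one hy (mem_range.1 hi) (.inl ⟨rfl, rfl⟩)
  · exact dvd_pow_mul_qChoose_mul_qFac_sub_one hy (mem_range.1 hi) (.inr ⟨rfl, rfl⟩)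

/-- The infinite product `∏_{i ≥ 1} (1 - y^(2 i))`. -/
noncomputable def evenProd (y : ℤ⟦X⟧) : ℤ⟦X⟧ := ∏' i : ℕ, (1 - (y ^ 2) ^ (i + 1))

/-- The infinite product `∏_{i ≥ 0} (1 - y^(2 i + 1))`. -/
noncomputable def oddProd (y : ℤ⟦X⟧) : ℤ⟦X⟧ := ∏' i : ℕ, (1 - y ^ (2 * i + 1))

lemma multipliable_one_sub {f : ℕ → ℤ⟦X⟧} (hf : ∀ i, X ^ i ∣ f i) :
    Multipliable fun i => 1 - f i := by
  simp_rw [sub_eq_add_neg]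
  apply WithPiTopology.multipliable_one_add_of_tendsto_order_atTop_nhds_top
  refine ENat.tendsto_nhds_top_iff_natCast_lt.mpr fun n => eventually_atTop.mpr ⟨n + 1, ?_⟩
  intro m hm
  rw [order_neg]
  refine lt_of_lt_of_le (by exact_mod_cast hm) (nat_le_order _ m fun i hi => ?_)
  exact X_pow_dvd_iff.1 (hf m) i hi

lemma multipliable_one_sub_pow (hy : X ∣ y) {f : ℕ → ℕ} (hf : ∀ i, i ≤ f i) :
    Multipliable fun i => 1 - y ^ f i :=
  multipliable_one_sub fun i => (pow_dvd_pow _ (hf i)).trans (pow_dvd_pow_of_dvd hy _)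

lemma multipliable_evenProd (hy : X ∣ y) : Multipliable fun i : ℕ => 1 - (y ^ 2) ^ (i + 1) :=
  multipliable_one_sub_pow (dvd_pow hy two_ne_zero) fun i => by omega

lemma multipliable_oddProd (hy : X ∣ y) : Multipliable fun i : ℕ => 1 - y ^ (2 * i + 1) :=
  multipliable_one_sub_pow hy fun i => by omega

lemma tendsto_of_X_pow_dvd_sub {f : ℕ → ℤ⟦X⟧} {g : ℤ⟦X⟧} (h : ∀ n, X ^ n ∣ f n - g) :
    Tendsto f atTop (nhds g) := by
  rw [WithPiTopology.tendsto_iff_coeff_tendsto]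
  intro d
  refine tendsto_atTop_of_eventually_const (i₀ := d + 1) fun n hn => ?_
  have := X_pow_dvd_iff.1 (h n) d hn
  rwa [map_sub, sub_eq_zero] at this

/-- Gauss's product for the theta series. -/
lemma theta_neg_eq {k : ℕ} (hk : 0 < k) {ε : ℤ} (hε : ε = 1 ∨ ε = -1) :
    theta k (-ε) = evenProd (C ε * X ^ k) * oddProd (C ε * X ^ k) ^ 2 := by
  set y : ℤ⟦X⟧ := C ε * X ^ k with hyd
  have hy : X ∣ y := Dvd.dvd.mul_left (dvd_pow_self _ hk.ne') _
  have hy0 : y ≠ 0 := by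
    rcases hε with rfl | rfl <;> simp [hyd]
  have hlim := ((multipliable_evenProd hy).hasProd.tendsto_prod_nat).mul
    (((multipliable_oddProd hy).hasProd.tendsto_prod_nat).pow 2)
  refine tendsto_nhds_unique (tendsto_of_X_pow_dvd_sub fun n => ?_) hlim
  have h1 := (pow_dvd_pow_of_dvd hy n).trans (pow_dvd_gauss_sub hy hy0 n)
  have h2 := X_pow_dvd_sqSeries_sub hk (fun j => (-ε) ^ j) n
  have h3 : ∑ i ∈ range n, (-1) ^ (i + 1) * y ^ (i + 1) ^ 2 =
      ∑ j ∈ range n, C ((-ε) ^ (j + 1)) * X ^ (k * (j + 1) ^ 2) := by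
    refine sum_congr rfl fun j _ => ?_
    have h4 : ε ^ (j + 1) ^ 2 = ε ^ (j + 1) := by
      rcases hε with rfl | rfl
      · simp
      · rcases Nat.even_or_odd (j + 1) with h | h
        · rw [h.neg_one_pow, (h.pow_of_ne_zero two_ne_zero).neg_one_pow]
        · rw [h.neg_one_pow, h.pow.neg_one_pow]
    rw [hyd, mul_pow, ← map_pow, h4, ← pow_mul, neg_pow ε, map_mul,
      map_pow C (-1), map_neg, map_one, map_pow]
    ring
  rw [h3] at h1
  have := dvd_sub h1 (Dvd.dvd.mul_left h2 2)
  refine this.trans (dvd_of_eq ?_)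
  rw [theta, qFac]
  ring

lemma oddProd_sq (hy : X ∣ y) : oddProd (y ^ 2) = oddProd y * oddProd (-y) := by
  rw [oddProd, oddProd, oddProd,
    ← (multipliable_oddProd hy).tprod_mul (multipliable_oddProd (dvd_neg.2 hy))]
  refine tprod_congr fun i => ?_
  rw [(odd_two_mul_add_one i).neg_pow]
  ring

lemma evenProd_eq (hy : X ∣ y) : evenProd y = evenProd (y ^ 2) * oddProd (y ^ 2) := by
  have hy2 : X ∣ y ^ 2 := dvd_pow hy two_ne_zero
  rw [evenProd, evenProd, oddProd, mul_comm,
    ← tprod_even_mul_odd (f := fun i => 1 - (y ^ 2) ^ (i + 1))]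
  · congr 1
    exact tprod_congr fun i => by rw [← pow_mul (y ^ 2)]; ring_nf
  · exact multipliable_oddProd hy2
  · exact multipliable_one_sub_pow hy2 fun i => by omega

lemma evenProd_neg (y : ℤ⟦X⟧) : evenProd (-y) = evenProd y := by
  rw [evenProd, neg_sq, evenProd]

end products

/-- This and its companion below express the quotients of odd products in the generating function as
quotients of theta series. -/
lemma theta_one_mul_oddProd {k : ℕ} (hk : 0 < k) :
    theta k 1 * oddProd (X ^ k) = theta (2 * k) (-1) * oddProd (-X ^ k) := by
  have hX : (X : ℤ⟦X⟧) ∣ X ^ k := dvd_pow_self _ hk.ne'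
  have h1 := theta_neg_eq hk (ε := -1) (.inr rfl)
  have h2 := theta_neg_eq (k := 2 * k) (by omega) (ε := 1) (.inl rfl)
  simp only [neg_neg, map_neg, map_one, neg_mul, one_mul, evenProd_neg] at h1 h2
  rw [h1, h2, mul_comm 2 k, pow_mul, evenProd_eq hX, oddProd_sq hX]
  ring

lemma theta_neg_one_mul_oddProd {k : ℕ} (hk : 0 < k) :
    theta k (-1) * oddProd (-X ^ k) = theta (2 * k) (-1) * oddProd (X ^ k) := by
  have hX : (X : ℤ⟦X⟧) ∣ X ^ k := dvd_pow_self _ hk.ne'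
  have h1 := theta_neg_eq hk (ε := 1) (.inl rfl)
  have h2 := theta_neg_eq (k := 2 * k) (by omega) (ε := 1) (.inl rfl)
  simp only [map_one, one_mul] at h1 h2
  rw [h1, h2, mul_comm 2 k, pow_mul, evenProd_eq hX, oddProd_sq hX]
  ring

lemma oddProd_ne_zero {y : ℤ⟦X⟧} (hy : X ∣ y) : oddProd y ≠ 0 := by
  intro h
  have h1 := (multipliable_oddProd hy).map_tprod _ (WithPiTopology.continuous_constantCoeff ℤ)
  rw [X_dvd_iff] at hy
  rw [← oddProd, h] at h1
  simp [hy] at h1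

lemma theta_one_mul_theta_neg_one {k : ℕ} (hk : 0 < k) :
    theta k 1 * theta k (-1) = theta (2 * k) (-1) ^ 2 := by
  have hX : (X : ℤ⟦X⟧) ∣ X ^ k := dvd_pow_self _ hk.ne'
  have h := mul_ne_zero (oddProd_ne_zero hX) (oddProd_ne_zero (dvd_neg.2 hX))
  apply mul_right_cancel₀ h
  linear_combination theta k (-1) * oddProd (-X ^ k) * theta_one_mul_oddProd hk +
    theta (2 * k) (-1) * oddProd (-X ^ k) * theta_neg_one_mul_oddProd hk

/-! ### The generating function as a theta quotient -/

/-- The generating function of the `9`-Schur overpartitions. -/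
noncomputable def schurGenFun : ℤ⟦X⟧ :=
  Nat.Partition.genFun fun i _ => if i % 18 ∈ schurResidues 9 then 2 else 0

/-- Each distinct part size is overlined or not, so it has weight 2 whatever its multiplicity. -/
lemma coeff_schurGenFun (n : ℕ) : coeff n schurGenFun = numSchurOverpartitions 9 n := by
  rw [schurGenFun, Nat.Partition.coeff_genFun, numSchurOverpartitions, schurOverpartitions,
    card_sigma, schurPartitions, sum_filter, Nat.cast_sum]
  refine sum_congr rfl fun p _ => ?_
  rw [Finsupp.prod, Multiset.toFinsupp_support, prod_ite_zero]
  simp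

lemma mod_mem_schurResidues_iff (m : ℕ) :
    m % 18 ∈ schurResidues 9 ↔ m % 2 = 1 ∧ ¬ 9 ∣ m := by
  simp only [schurResidues, mem_erase, mem_filter, mem_range, Nat.odd_iff]
  omega

/-- The factor of `∏ (1 - y^(2 j + 1))`, over the `j` with `9 ∤ 2 j + 1`, of index `j`. -/
noncomputable def oddFactor (y : ℤ⟦X⟧) (j : ℕ) : ℤ⟦X⟧ :=
  1 - if 9 ∣ 2 * j + 1 then 0 else y ^ (2 * j + 1)

lemma multipliable_oddFactor {y : ℤ⟦X⟧} (hy : X ∣ y) : Multipliable (oddFactor y) := by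
  refine multipliable_one_sub fun i => ?_
  split_ifs
  · exact dvd_zero _
  · exact (pow_dvd_pow _ (by omega)).trans (pow_dvd_pow_of_dvd hy _)

lemma oddProd_eq_mul {y : ℤ⟦X⟧} (hy : X ∣ y) :
    oddProd y = (∏' j, oddFactor y j) * oddProd (y ^ 9) := by
  set g : ℕ → ℤ⟦X⟧ := fun j => 1 - if 9 ∣ 2 * j + 1 then y ^ (2 * j + 1) else 0 with hg
  -- The odd multiples of 9 are 2j + 1 = 9(2i + 1), that is, j = 9i + 4.
  have hi : Function.Injective fun i : ℕ => 9 * i + 4 := fun a b h => by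
    simp only at h; omega
  have h1 : HasProd g (oddProd (y ^ 9)) := by
    rw [← hi.hasProd_iff]
    · convert (multipliable_oddProd (y := y ^ 9) (dvd_pow hy (by norm_num))).hasProd using 1
      swap
      · rfl
      ext1 i
      simp only [hg, Function.comp_apply]
      rw [if_pos (by omega), ← pow_mul]
      ring_nf
    · intro j hj
      simp only [hg]
      rw [if_neg, sub_zero]
      intro h
      exact hj ⟨j / 9, by simp only; omega⟩
  rw [← h1.tprod_eq, ← (multipliable_oddFactor hy).tprod_mul h1.multipliable, oddProd]
  refine tprod_congr fun j => ?_
  simp only [oddFactor, hg]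
  split_ifs <;> ring

/-- With x = X^m, an admissible part m contributes 1 + 2(x + x² + ⋯) = (1 + x)/(1 - x). -/
lemma schurGenFun_mul_tprod :
    schurGenFun * ∏' j, oddFactor X j = ∏' j, oddFactor (-X) j := by
  have h := Nat.Partition.hasProd_genFun
    fun i _ => if i % 18 ∈ schurResidues 9 then (2 : ℤ) else 0
  have hi : Function.Injective fun i : ℕ => 2 * i := fun a b h => by
    simp only at h; omega
  simp only [PowerSeries.smul_eq_C_mul] at h
  rw [← hi.hasProd_iff] at h
  · rw [schurGenFun, ← h.tprod_eq, ← h.multipliable.tprod_mul (multipliable_oddFactor dvd_rfl)]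
    refine tprod_congr fun j => ?_
    simp only [Function.comp_apply, mod_mem_schurResidues_iff, oddFactor]
    by_cases h9 : 9 ∣ 2 * j + 1
    · simp [h9]
    · have h2 : (2 * j + 1) % 2 = 1 := by omega
      have hX : constantCoeff ((X : ℤ⟦X⟧) ^ (2 * j + 1)) = 0 := by simp
      have h3 := WithPiTopology.tsum_pow_mul_one_sub_of_constantCoeff_eq_zero hX
      have h4 : ∑' i : ℕ, C (2 : ℤ) * (X : ℤ⟦X⟧) ^ ((2 * j + 1) * (i + 1)) =
          2 * X ^ (2 * j + 1) * ∑' i : ℕ, (X ^ (2 * j + 1)) ^ i := by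
        rw [← (WithPiTopology.summable_pow_of_constantCoeff_eq_zero hX).tsum_mul_left]
        refine tsum_congr fun i => ?_
        rw [pow_mul, pow_succ, map_ofNat]
        ring
      simp only [h9, h2, not_false_eq_true, and_self, if_true, if_false]
      rw [h4, (odd_two_mul_add_one j).neg_pow]
      linear_combination 2 * X ^ (2 * j + 1) * h3
  · intro j hj
    have : (j + 1) % 2 ≠ 1 := fun h => hj ⟨j / 2, by simp only; omega⟩
    simp [mod_mem_schurResidues_iff, this]

lemma schurGenFun_mul_oddProd :
    schurGenFun * (oddProd X * oddProd (-X ^ 9)) = oddProd (-X) * oddProd (X ^ 9) := by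
  have hn : (-X : ℤ⟦X⟧) ^ 9 = -X ^ 9 := Odd.neg_pow (by decide) _
  rw [oddProd_eq_mul dvd_rfl, oddProd_eq_mul (dvd_neg.2 dvd_rfl), hn, ← schurGenFun_mul_tprod]
  ring

lemma schurGenFun_mul_theta :
    schurGenFun * (theta 4 (-1) * theta 36 (-1)) ^ 2 =
      theta 1 1 * theta 9 (-1) * (theta 2 1 * theta 18 1) := by
  have h1 := theta_one_mul_oddProd one_pos
  have h9 := theta_neg_one_mul_oddProd (k := 9) (by norm_num)
  have h2 := theta_one_mul_theta_neg_one two_pos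
  have h18 := theta_one_mul_theta_neg_one (k := 18) (by norm_num)
  have hS := schurGenFun_mul_oddProd
  norm_num at h1 h9 h2 h18
  have hX : (X : ℤ⟦X⟧) ∣ X ^ 9 := dvd_pow_self _ (by norm_num)
  have hne := mul_ne_zero (oddProd_ne_zero (dvd_refl X)) (oddProd_ne_zero (dvd_neg.2 hX))
  have key : schurGenFun * (theta 2 (-1) * theta 18 (-1)) = theta 1 1 * theta 9 (-1) := by
    apply mul_right_cancel₀ hne
    linear_combination theta 2 (-1) * theta 18 (-1) * hS -
      theta 9 (-1) * oddProd (-X ^ 9) * h1 - theta 2 (-1) * oddProd (-X) * h9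
  rw [mul_pow, ← h2, ← h18]
  linear_combination theta 2 1 * theta 18 1 * key

/-! ### Dissections and exponents modulo 3, 4 and 24 -/

lemma sqSeries_eq_add (k : ℕ) {c c₁ c₂ : ℕ → ℤ} (h : ∀ j, c j = c₁ j + c₂ j) :
    sqSeries k c = sqSeries k c₁ + sqSeries k c₂ := by
  ext n
  simp only [sqSeries, coeff_mk, map_add, ← sum_add_distrib, h]
  refine sum_congr rfl fun j _ => ?_
  split_ifs <;> simp

lemma sqSeries_mul_sq {k m : ℕ} (hk : 0 < k) (hm : 0 < m) {c d : ℕ → ℤ} (h : ∀ i, c (m * i) = d i)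
    (h' : ∀ j, ¬ m ∣ j → c j = 0) : sqSeries k c = sqSeries (k * m ^ 2) d := by
  ext n
  rw [coeff_sqSeries hk c (Nat.le_mul_of_pos_left n hm),
    coeff_sqSeries (by positivity) d le_rfl]
  have hinj : Set.InjOn (fun i => m * i) (Icc 1 n : Finset ℕ) := fun a _ b _ hab =>
    Nat.eq_of_mul_eq_mul_left hm hab
  have hs : (Icc 1 n).image (fun i => m * i) ⊆ Icc 1 (m * n) := by
    intro j hj
    obtain ⟨i, hi, rfl⟩ := mem_image.1 hj
    rw [mem_Icc] at hi ⊢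
    exact ⟨Nat.mul_pos hm hi.1, Nat.mul_le_mul_left m hi.2⟩
  rw [← sum_subset hs, sum_image hinj]
  · refine sum_congr rfl fun i _ => ?_
    rw [h, mul_pow, mul_assoc]
  · intro j hj hj'
    rw [h' j, ite_self]
    rintro ⟨i, rfl⟩
    refine hj' (mem_image_of_mem _ ?_)
    rw [mem_Icc] at hj ⊢
    exact ⟨Nat.pos_of_mul_pos_left hj.1, Nat.le_of_mul_le_mul_left hj.2 hm⟩

/-- The sum of `X^(k j^2)` over the positive `j` whose residue modulo `6` satisfies `p`. -/
noncomputable def sqSum (k : ℕ) (p : ℕ → Bool) : ℤ⟦X⟧ :=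
  sqSeries k fun j => if p (j % 6) then 1 else 0

lemma theta_eq {k : ℕ} (hk : 0 < k) {ε : ℤ} (hε : ε = 1 ∨ ε = -1) :
    theta k ε = theta (4 * k) 1 + C (2 * ε) * sqSum k fun r => r % 2 = 1 := by
  have h : sqSeries k (fun j => ε ^ j) =
      sqSeries (4 * k) (fun j => 1 ^ j) + C ε * sqSum k fun r => r % 2 = 1 := by
    have e : C ε * sqSum k (fun r => r % 2 = 1) =
        sqSeries k fun j => if j % 2 = 1 then ε else 0 := by
      ext n
      simp only [sqSum, sqSeries, coeff_C_mul, coeff_mk, mul_sum]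
      refine sum_congr rfl fun j _ => ?_
      have : j % 6 % 2 = j % 2 := Nat.mod_mod_of_dvd _ (by norm_num)
      simp [this]
    rw [e, show 4 * k = k * 2 ^ 2 by ring, ← sqSeries_mul_sq (d := fun j => 1 ^ j)
      (c := fun j => if j % 2 = 1 then 0 else 1) hk two_pos (by simp)
      fun j hj => if_pos (by omega)]
    refine sqSeries_eq_add k fun j => ?_
    rcases Nat.mod_two_eq_zero_or_one j with h | h
    · rcases hε with rfl | rfl
      · simp [h]
      · simp [h, (Nat.even_iff.2 h).neg_one_pow]
    · rcases hε with rfl | rfl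
      · simp [h]
      · simp [h, (Nat.odd_iff.2 h).neg_one_pow]
  rw [theta, theta, h, map_mul, map_ofNat]
  ring

/-- All exponents of `f` have a residue modulo `m` that lies in `A`. -/
def ExpMod (m : ℕ) (A : Finset ℕ) (f : ℤ⟦X⟧) : Prop :=
  ∀ n, coeff n f ≠ 0 → n % m ∈ A

namespace ExpMod

variable {m : ℕ} {A B D : Finset ℕ} {f g : ℤ⟦X⟧}

lemma coeff_eq_zero (hf : ExpMod m A f) {n : ℕ} (hn : n % m ∉ A) : coeff n f = 0 := by
  by_contra h
  exact hn (hf n h)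

lemma add (hf : ExpMod m A f) (hg : ExpMod m A g) : ExpMod m A (f + g) := by
  intro n hn
  by_contra h
  rw [map_add, hf.coeff_eq_zero h, hg.coeff_eq_zero h, add_zero] at hn
  exact hn rfl

lemma neg (hf : ExpMod m A f) : ExpMod m A (-f) := by
  intro n hn
  rw [map_neg, neg_ne_zero] at hn
  exact hf n hn

lemma sub (hf : ExpMod m A f) (hg : ExpMod m A g) : ExpMod m A (f - g) := by
  rw [sub_eq_add_neg]
  exact hf.add hg.neg

lemma two_mul (hf : ExpMod m A f) : ExpMod m A (2 * f) := by
  rw [_root_.two_mul]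
  exact hf.add hf

lemma mul (hf : ExpMod m A f) (hg : ExpMod m B g) (h : ∀ a ∈ A, ∀ b ∈ B, (a + b) % m ∈ D) :
    ExpMod m D (f * g) := by
  intro n hn
  rw [coeff_mul] at hn
  obtain ⟨⟨a, b⟩, hab, h0⟩ := exists_ne_zero_of_sum_ne_zero hn
  rw [HasAntidiagonal.mem_antidiagonal] at hab
  have := h _ (hf a (left_ne_zero_of_mul h0)) _ (hg b (right_ne_zero_of_mul h0))
  rwa [← Nat.add_mod, hab] at this

lemma one (h : 0 ∈ A) : ExpMod m A 1 := by
  intro n hn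
  rw [coeff_one] at hn
  obtain rfl : n = 0 := by by_contra h; simp [h] at hn
  simpa using h

/-- For m ∣ 24, both k j² mod m and j mod 6 depend only on j mod 24, so a finite check suffices. -/
lemma sqSeries {k : ℕ} {c : ℕ → ℤ} {p : ℕ → Bool} (hc : ∀ j, c j ≠ 0 → p (j % 6)) (hm : m ∣ 24)
    (h : ∀ r < 24, p (r % 6) → k * r ^ 2 % m ∈ A) : ExpMod m A (sqSeries k c) := by
  intro n hn
  rw [_root_.sqSeries, coeff_mk] at hn
  obtain ⟨j, -, h0⟩ := exists_ne_zero_of_sum_ne_zero hn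
  rw [ne_eq, ite_eq_right_iff, not_forall] at h0
  obtain ⟨rfl, h0⟩ := h0
  have h1 := h (j % 24) (Nat.mod_lt _ (by norm_num))
    (by rw [Nat.mod_mod_of_dvd _ (by norm_num)]; exact hc j h0)
  have h2 : k * (j % 24) ^ 2 ≡ k * j ^ 2 [MOD m] :=
    (((Nat.mod_modEq j 24).of_dvd hm).pow 2).mul_left k
  rwa [h2] at h1

lemma sqSum {k : ℕ} {p : ℕ → Bool} (hm : m ∣ 24)
    (h : ∀ r < 24, p (r % 6) → k * r ^ 2 % m ∈ A) : ExpMod m A (sqSum k p) :=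
  sqSeries (fun j hj => by by_contra h; simp [h] at hj) hm h

lemma theta {k : ℕ} {ε : ℤ} (hm : m ∣ 24) (h : ∀ r < 24, k * r ^ 2 % m ∈ A) :
    ExpMod m A (theta k ε) :=
  (one (by simpa using h 0)).add
    (two_mul (sqSeries (p := fun _ => true) (fun _ _ => rfl) hm fun r hr _ => h r hr))

end ExpMod

lemma sqSum_odd_eq {k : ℕ} (hk : 0 < k) :
    sqSum k (fun r => r % 2 = 1) =
      sqSum (9 * k) (fun r => r % 2 = 1) + sqSum k fun r => r % 2 = 1 ∧ r % 3 ≠ 0 := by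
  rw [sqSum, sqSum, sqSum, show 9 * k = k * 3 ^ 2 by ring, ← sqSeries_mul_sq
    (c := fun j => if j % 2 = 1 ∧ j % 3 = 0 then 1 else 0) hk three_pos]
  · refine sqSeries_eq_add k fun j => ?_
    have h2 : j % 6 % 2 = j % 2 := Nat.mod_mod_of_dvd _ (by norm_num)
    have h3 : j % 6 % 3 = j % 3 := Nat.mod_mod_of_dvd _ (by norm_num)
    by_cases h : j % 2 = 1 <;> by_cases h' : j % 3 = 0 <;> simp [h2, h3, h, h']
  · intro i
    have h2 : i % 6 % 2 = 3 * i % 2 := by omega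
    simp [h2]
  · intro j hj
    rw [if_neg (by omega)]

lemma theta_one_eq {k : ℕ} (hk : 0 < k) :
    theta k 1 = theta (9 * k) 1 + 2 * sqSum k fun r => r % 3 ≠ 0 := by
  rw [theta, theta, add_assoc, ← mul_add]
  congr 2
  rw [sqSum, show 9 * k = k * 3 ^ 2 by ring, ← sqSeries_mul_sq
    (c := fun j => if j % 3 = 0 then 1 else 0) hk three_pos]
  · refine sqSeries_eq_add k fun j => ?_
    have h3 : j % 6 % 3 = j % 3 := Nat.mod_mod_of_dvd _ (by norm_num)
    by_cases h' : j % 3 = 0 <;> simp [h3, h']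
  · simp
  · intro j hj
    rw [if_neg (by omega)]

/-- The part of `f` with exponents congruent to `r` modulo `m`. -/
noncomputable def expPart (m r : ℕ) (f : ℤ⟦X⟧) : ℤ⟦X⟧ :=
  PowerSeries.mk fun n => if n % m = r then coeff n f else 0

lemma expPart_mul {m r : ℕ} (f : ℤ⟦X⟧) {g : ℤ⟦X⟧} (hg : ExpMod m {0} g) :
    expPart m r (f * g) = expPart m r f * g := by
  ext n
  rw [expPart, coeff_mk, coeff_mul, coeff_mul]
  have h (p : ℕ × ℕ) (hp : p ∈ HasAntidiagonal.antidiagonal n) :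
      coeff p.1 (expPart m r f) * coeff p.2 g =
        if n % m = r then coeff p.1 f * coeff p.2 g else 0 := by
    rw [HasAntidiagonal.mem_antidiagonal] at hp
    by_cases h0 : coeff p.2 g = 0
    · simp [h0]
    · have h1 : p.2 % m = 0 := by simpa using hg _ h0
      have h2 : n % m = p.1 % m := by
        rw [← hp, Nat.add_mod, h1, add_zero, Nat.mod_mod]
      rw [expPart, coeff_mk, h2, ite_mul, zero_mul]
  rw [sum_congr rfl h]
  split_ifs <;> simp

lemma expPart_eq {m r : ℕ} {A : Finset ℕ} {f g : ℤ⟦X⟧} (hA : r ∉ A) (hg : ExpMod m {r} g)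
    (h : ExpMod m A (f - g)) : expPart m r f = g := by
  ext n
  rw [expPart, coeff_mk]
  split_ifs with hn
  · exact sub_eq_zero.1 (by rw [← map_sub]; exact h.coeff_eq_zero (by rwa [hn]))
  · exact (hg.coeff_eq_zero (by simpa using hn)).symm

lemma coeff_ofNat_mul (a : ℕ) [a.AtLeastTwo] (f : ℤ⟦X⟧) (n : ℕ) :
    coeff n (OfNat.ofNat a * f) = OfNat.ofNat a * coeff n f := by
  rw [← map_ofNat C, coeff_C_mul]

/-! ### The part with exponents 3 modulo 4 -/

/-- The power series `H` such that `4 H` is the part with exponents `3` modulo `4` of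
`φ(q) φ(-q^9) φ(q^2) φ(q^18)`, where `φ(q) = ∑ q^(j^2)`. -/
noncomputable def thetaQuarter : ℤ⟦X⟧ :=
  (sqSum 1 (fun r => r % 2 = 1) * theta 36 1 - theta 4 1 * sqSum 9 fun r => r % 2 = 1) *
    (sqSum 2 (fun r => r % 2 = 1) * theta 72 1 + theta 8 1 * sqSum 18 fun r => r % 2 = 1)

lemma expPart_schurGenFun_mul :
    expPart 4 3 schurGenFun * (theta 4 (-1) * theta 36 (-1)) ^ 2 = 4 * thetaQuarter := by
  have d4 : 4 ∣ 24 := by norm_num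
  have t4 (ε) : ExpMod 4 {0} (theta 4 ε) := .theta d4 (by decide)
  have t8 : ExpMod 4 {0} (theta 8 1) := .theta d4 (by decide)
  have t36 (ε) : ExpMod 4 {0} (theta 36 ε) := .theta d4 (by decide)
  have t72 : ExpMod 4 {0} (theta 72 1) := .theta d4 (by decide)
  have o1 : ExpMod 4 {1} (sqSum 1 fun r => r % 2 = 1) := .sqSum d4 (by decide)
  have o9 : ExpMod 4 {1} (sqSum 9 fun r => r % 2 = 1) := .sqSum d4 (by decide)
  have o2 : ExpMod 4 {2} (sqSum 2 fun r => r % 2 = 1) := .sqSum d4 (by decide)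
  have o18 : ExpMod 4 {2} (sqSum 18 fun r => r % 2 = 1) := .sqSum d4 (by decide)
  have e1 := theta_eq one_pos (.inl rfl : (1 : ℤ) = 1 ∨ _)
  have e9 := theta_eq (k := 9) (by norm_num) (.inr rfl : _ ∨ (-1 : ℤ) = -1)
  have e2 := theta_eq two_pos (.inl rfl : (1 : ℤ) = 1 ∨ _)
  have e18 := theta_eq (k := 18) (by norm_num) (.inl rfl : (1 : ℤ) = 1 ∨ _)
  norm_num at e1 e9 e2 e18
  have hU := (o1.mul (t36 1) (D := {1}) (by decide)).sub ((t4 1).mul o9 (by decide))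
  have hV := (o2.mul t72 (D := {2}) (by decide)).add (t8.mul o18 (by decide))
  have hH : ExpMod 4 {3} thetaQuarter := hU.mul hV (by decide)
  have hD : ExpMod 4 {0} ((theta 4 (-1) * theta 36 (-1)) ^ 2) := by
    have := (t4 (-1)).mul (t36 (-1)) (D := {0}) (by decide)
    rw [sq]
    exact this.mul this (by decide)
  rw [← expPart_mul _ hD, schurGenFun_mul_theta]
  have h2 : (4 : ℤ⟦X⟧) * thetaQuarter = 2 * (2 * thetaQuarter) := by ring
  refine expPart_eq (A := {0, 1, 2}) (by decide) (h2 ▸ hH.two_mul.two_mul) ?_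
  have f1 := ((t4 1).mul (t36 1) (D := {0, 2}) (by decide)).sub
    (o1.mul o9 (by decide)).two_mul.two_mul
  have f2 := (t8.mul t72 (D := {0}) (by decide)).add (o2.mul o18 (by decide)).two_mul.two_mul
  -- The two pairs of theta series multiply to f₁ + 2U and f₂ + 2V with H = UV; the terms other than
  -- 4UV have no exponent 3 mod 4.
  have f3 := (f1.mul f2 (D := {0, 1, 2}) (by decide)).add
    ((f1.mul hV (by decide)).add (hU.mul f2 (by decide))).two_mul
  convert f3 using 1
  rw [e1, e2, e9, e18, thetaQuarter]
  ring

/-- The contributions with 3 ∣ j cancel in the first factor of H thanks to its minus sign, leaving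
only exponents 1 mod 3; the second factor has only exponents 0 and 2. -/
lemma expMod_three_thetaQuarter : ExpMod 3 {0, 1} thetaQuarter := by
  have d3 : 3 ∣ 24 := by norm_num
  have t36 : ExpMod 3 {0} (theta 36 1) := .theta d3 (by decide)
  have t72 : ExpMod 3 {0} (theta 72 1) := .theta d3 (by decide)
  have o9 : ExpMod 3 {0} (sqSum 9 fun r => r % 2 = 1) := .sqSum d3 (by decide)
  have o18 : ExpMod 3 {0} (sqSum 18 fun r => r % 2 = 1) := .sqSum d3 (by decide)
  have p1 : ExpMod 3 {1} (sqSum 1 fun r => r % 2 = 1 ∧ r % 3 ≠ 0) := .sqSum d3 (by decide)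
  have p2 : ExpMod 3 {2} (sqSum 2 fun r => r % 2 = 1 ∧ r % 3 ≠ 0) := .sqSum d3 (by decide)
  have b4 : ExpMod 3 {1} (sqSum 4 fun r => r % 3 ≠ 0) := .sqSum d3 (by decide)
  have b8 : ExpMod 3 {2} (sqSum 8 fun r => r % 3 ≠ 0) := .sqSum d3 (by decide)
  have hU := (p1.mul t36 (D := {1}) (by decide)).sub (b4.mul o9 (by decide)).two_mul
  have hV := (p2.mul t72 (D := {0, 2}) (by decide)).add
    ((o18.mul t72 (by decide)).add (b8.mul o18 (by decide))).two_mul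
  convert hU.mul hV (D := {0, 1}) (by decide) using 1
  have := theta_one_eq (k := 4) (by norm_num)
  have := theta_one_eq (k := 8) (by norm_num)
  have := sqSum_odd_eq (k := 1) (by norm_num)
  have := sqSum_odd_eq (k := 2) (by norm_num)
  simp only [Nat.reduceMul] at *
  simp only [thetaQuarter, *]
  ring

lemma thetaQuarter_eq : ∃ h : ℤ⟦X⟧, thetaQuarter =
    sqSum 1 (fun r => r % 2 = 1 ∧ r % 3 ≠ 0) * sqSum 2 (fun r => r % 2 = 1 ∧ r % 3 ≠ 0) +
      2 * h := by
  have h4 := theta_one_eq (k := 4) (by norm_num)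
  have h8 := theta_one_eq (k := 8) (by norm_num)
  have h1 := sqSum_odd_eq (k := 1) (by norm_num)
  have h2 := sqSum_odd_eq (k := 2) (by norm_num)
  simp only [Nat.reduceMul] at h4 h8 h1 h2
  rw [thetaQuarter, h1, h2, h4, h8]
  set p1 := sqSum 1 fun r => r % 2 = 1 ∧ r % 3 ≠ 0
  set p2 := sqSum 2 fun r => r % 2 = 1 ∧ r % 3 ≠ 0
  set o9 := sqSum 9 fun r => r % 2 = 1
  set o18 := sqSum 18 fun r => r % 2 = 1
  set b4 := sqSum 4 fun r => r % 3 ≠ 0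
  set b8 := sqSum 8 fun r => r % 3 ≠ 0
  set s36 : ℤ⟦X⟧ := sqSeries 36 fun j => 1 ^ j with h36
  set s72 : ℤ⟦X⟧ := sqSeries 72 fun j => 1 ^ j with h72
  rw [theta, theta, ← h36, ← h72]
  exact ⟨p1 * (p2 * s72 + (o18 * (1 + 2 * s72) + b8 * o18)) +
    (p1 * s36 - b4 * o9) * (p2 + 2 * (p2 * s72 + (o18 * (1 + 2 * s72) + b8 * o18))), by ring⟩

lemma sqSeries_neg_one_pow_eq (k : ℕ) :
    sqSeries k (fun j => (-1) ^ j) =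
      sqSum k (fun r => r % 2 = 0) - sqSum k fun r => r % 2 = 1 := by
  rw [eq_sub_iff_add_eq]
  refine (sqSeries_eq_add k fun j => ?_).symm
  have h2 : j % 6 % 2 = j % 2 := Nat.mod_mod_of_dvd _ (by norm_num)
  rcases Nat.mod_two_eq_zero_or_one j with h | h
  · simp [h2, h, (Nat.even_iff.2 h).neg_one_pow]
  · simp [h2, h, (Nat.odd_iff.2 h).neg_one_pow]

/-! ### The denominator modulo 8 and the congruences -/

lemma theta_mul_theta_sq_eq : ∃ e₀ e₁ : ℤ⟦X⟧, ExpMod 24 ((range 24).erase 20) e₀ ∧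
    (theta 4 (-1) * theta 36 (-1)) ^ 2 = 1 + 4 * (e₀ + 2 * e₁) := by
  have hs := sqSeries_neg_one_pow_eq 4
  rw [theta, theta]
  set s : ℤ⟦X⟧ := sqSeries 4 fun j => (-1) ^ j with hsd
  set t : ℤ⟦X⟧ := sqSeries 36 fun j => (-1) ^ j with htd
  set u := sqSum 4 fun r => r % 2 = 0 with hud
  set v := sqSum 4 fun r => r % 2 = 1 with hvd
  have s4 : ExpMod 24 ((range 24).erase 20) s :=
    .sqSeries (p := fun _ => true) (fun _ _ => rfl) dvd_rfl (by decide)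
  have t36 : ExpMod 24 {0, 12} t :=
    .sqSeries (p := fun _ => true) (fun _ _ => rfl) dvd_rfl (by decide)
  have t36' : ExpMod 24 ((range 24).erase 20) t :=
    .sqSeries (p := fun _ => true) (fun _ _ => rfl) dvd_rfl (by decide)
  have hu : ExpMod 24 {0, 16} u := .sqSum dvd_rfl (by decide)
  have hv : ExpMod 24 {4, 12} v := .sqSum dvd_rfl (by decide)
  -- Here (1+2s)² = 1 + 4(s+s²), likewise for t, and s = u - v. The product u v can reach the
  -- residue 16 + 4 = 20, but in s² it carries a factor 2 and so goes into e₁.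
  refine ⟨s + u * u + v * v + (t + t * t), -(u * v) + 2 * ((s + s * s) * (t + t * t)),
    ((s4.add (hu.mul hu (by decide))).add (hv.mul hv (by decide))).add
      (t36'.add (t36.mul t36 (by decide))), ?_⟩
  have : s * s = u * u + v * v - 2 * (u * v) := by rw [hs]; ring
  linear_combination 4 * this

lemma coeff_schurGenFun_dvd {n : ℕ} (h4 : n % 4 = 3) (h3 : n % 3 = 2) :
    16 ∣ coeff n schurGenFun ∧ (n % 24 = 23 → 32 ∣ coeff n schurGenFun) := by
  obtain ⟨e₀, e₁, he, hD⟩ := theta_mul_theta_sq_eq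
  obtain ⟨h, hh⟩ := thetaQuarter_eq
  have key := expPart_schurGenFun_mul
  set D := (theta 4 (-1) * theta 36 (-1)) ^ 2 with hDd
  have hunit : IsUnit D := by
    rw [isUnit_iff_constantCoeff, hDd]
    have (k : ℕ) : constantCoeff (theta k (-1)) = 1 := by
      have h0 : constantCoeff (sqSeries k fun j => (-1) ^ j) = 0 := by
        rw [← coeff_zero_eq_constantCoeff_apply, sqSeries, coeff_mk]
        simp
      simp [theta, h0]
    simp [this]
  obtain ⟨D', hD'⟩ := hunit.exists_right_inv
  set K := thetaQuarter * D' with hK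
  have hS : expPart 4 3 schurGenFun = 4 * K := by
    linear_combination D' * key - expPart 4 3 schurGenFun * hD'
  have hc : coeff n schurGenFun = 4 * coeff n K := by
    rw [← coeff_ofNat_mul, ← hS, expPart, coeff_mk, if_pos h4]
  have hKD : K * (1 + 4 * (e₀ + 2 * e₁)) = thetaQuarter := by
    rw [← hD]; linear_combination thetaQuarter * hD'
  have hH : coeff n thetaQuarter = 0 :=
    expMod_three_thetaQuarter.coeff_eq_zero (by rw [h3]; decide)
  refine ⟨?_, fun h24 => ?_⟩
  · have : K = thetaQuarter + 4 * (-((e₀ + 2 * e₁) * K)) := by linear_combination hKD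
    rw [hc, this, map_add, hH, coeff_ofNat_mul]
    exact ⟨_, by ring⟩
  · set p := sqSum 1 (fun r => r % 2 = 1 ∧ r % 3 ≠ 0) *
      sqSum 2 (fun r => r % 2 = 1 ∧ r % 3 ≠ 0) with hpd
    have p1 : ExpMod 24 {1} (sqSum 1 fun r => r % 2 = 1 ∧ r % 3 ≠ 0) := .sqSum dvd_rfl (by decide)
    have p2 : ExpMod 24 {2} (sqSum 2 fun r => r % 2 = 1 ∧ r % 3 ≠ 0) := .sqSum dvd_rfl (by decide)
    have hp : ExpMod 24 ((range 24).erase 23) (e₀ * p) :=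
      he.mul (p1.mul p2 (D := {3}) (by decide)) (by decide)
    -- With E = e₀ + 2e₁, this is K = H - 4EH + 16E²K, where H = p + 2h.
    have : K = thetaQuarter - 4 * (e₀ * p) +
        8 * (-(e₁ * p) - (e₀ + 2 * e₁) * h + 2 * ((e₀ + 2 * e₁) ^ 2 * K)) := by
      linear_combination (1 - 4 * (e₀ + 2 * e₁)) * hKD - 4 * (e₀ + 2 * e₁) * hh
    rw [hc, this, map_add, map_sub, hH, coeff_ofNat_mul, coeff_ofNat_mul,
      hp.coeff_eq_zero (by rw [h24]; decide)]
    exact ⟨_, by ring⟩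

theorem mainTheorem11 (n : ℕ) :
    numSchurOverpartitions 9 (12 * n + 11) ≡ 0 [MOD 16] ∧
      numSchurOverpartitions 9 (24 * n + 23) ≡ 0 [MOD 32] := by
  have h1 := (coeff_schurGenFun_dvd (n := 12 * n + 11) (by omega) (by omega)).1
  have h2 := (coeff_schurGenFun_dvd (n := 24 * n + 23) (by omega) (by omega)).2 (by omega)
  rw [coeff_schurGenFun] at h1 h2
  exact ⟨(Nat.modEq_zero_iff_dvd).2 (by exact_mod_cast h1),
    (Nat.modEq_zero_iff_dvd).2 (by exact_mod_cast h2)⟩
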